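/- Throughout, \(A\) is a C*-algebra faithfully represented on a Hilbert space \(H\), and \(D_A\subseteq A\) is a C*-subalgebra which is nondegenerate, i.e. \(D_A\) contains an approximate unit for \(A\). Write \(\mathcal N_A(D)=\{a\in A: aDa^*\subseteq D,\ a^*Da\subseteq D\}\) for the set of normalisers of \(D\) in \(A\). A completely positive map \(\phi\) has order zero if \(\phi(a)\phi(a')=0\) whenever \(a,a'\ge 0\) and \(aa'=0\). For an order zero map \(\phi\colon E\to A\subseteq \mathcal B(H)\), put \(C=C^*(\phi(E))\) and regard its multiplier algebra \(\mathcal M(C)\) as an algebra of operators on \(\overline{CH}\subseteq H\) (extended by \(0\) on \((CH)^\perp\)); a supporting \(*\)-homomorphism for \(\phi\) is a \(*\)-homomorphism \(\pi\colon E\to\mathcal M(C)\cap\{h\}'\) such that \(\phi(a)=h\pi(a)\) for all \(a\in E\), where \(h\in\mathcal M(C)\cap C'\) is positive with \(\|h\|=\|\phi\|\). (Diagonal dimension.) Suppose \(D_A\) is abelian. Then \(\dim_{\mathrm{diag}}(D_A\subseteq A)\le d\) if for every finite \(\mathcal F\subseteq A\) and \(\varepsilon>0\) there are a finite-dimensional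 C*-algebra \(F=F^{(0)}\oplus\cdots\oplus F^{(d)}\) with a maximal abelian \(*\)-subalgebra \(D_F=D^{(0)}\oplus\cdots\oplus D^{(d)}\), \(D^{(i)}\subseteq F^{(i)}\), and completely positive maps \(A\xrightarrow{\psi}F\xrightarrow{\phi}A\) such that: (1) \(\psi\) is contractive; (2) \(\|\phi\psi(a)-a\|<\varepsilon\) for all \(a\in\mathcal F\); (3) each \(\phi^{(i)}=\phi|_{F^{(i)}}\) is contractive of order zero; (4) \(\psi(D_A)\subseteq D_F\); (5) \(\phi^{(i)}(\mathcal N_{F^{(i)}}(D^{(i)}))\subseteq\mathcal N_A(D_A)\) for each \(i\). (Generalised diagonal dimension.) Let \(B\) be a C*-algebra. Then \(\dim_{\mathrm{diag}}(D_A\subseteq A;B)\le d\) if for every finite \(\mathcal F\subseteq A\) and \(\varepsilon>0\) there are \(F=F^{(0)}\oplus\cdots\oplus F^{(d)}\), each \(F^{(i)}\) being a finite direct sum of matrix algebras over \(\mathbb C\) with canonical diagonal \(D^{(i)}\) (the diagonal matrices), \(D_F=\bigoplus_i D^{(i)}\), and completely positive maps \(A\xrightarrow{\psi}F\otimes B\xrightarrow{\phi}A\)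 such that: (1) \(\psi\) is contractive; (2) \(\|\phi\psi(a)-a\|<\varepsilon\) for all \(a\in\mathcal F\); (3) each \(\phi^{(i)}=\phi|_{F^{(i)}\otimes B}\) is contractive of order zero; (4) \(\psi(D_A)\subseteq D_F\otimes B\); (5) \(\phi^{(i)}(D^{(i)}\otimes B)\subseteq\mathcal N_A(D_A)\), and \(\phi^{(i)}(v\otimes B)\subseteq\mathcal N_A(D_A)\) for every matrix unit \(v\in F^{(i)}\) with respect to \(D^{(i)}\) (that is, \(vv^*\) and \(v^*v\) are minimal projections of \(D^{(i)}\)); (6) for each \(i\), each supporting \(*\)-homomorphism \(\pi^{(i)}\) for \(\phi^{(i)}\), each approximate unit \((u_\lambda)\) of \(B\) (consisting of positive contractions) and each minimal projection \(v\in D^{(i)}\), the strong operator limit \(\lim_\lambda\pi^{(i)}(v\otimes u_\lambda)\) exists in \(\mathcal B(H)\) and commutes with \(D_A\). In both cases the dimension is the least such \(d\in\{0,1,2,\dots\}\), and \(\infty\) if there is none. Proposition. Let \((D_A\subseteq A)\) be a nondegenerate C*-subalgebra with \(D_A\) abelian. Then \[\dim_{\mathrm{diag}}(D_A\subseteq A)=\dim_{\mathrm{diag}}(D_A\subseteq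 A;\mathbb C).\] -/

import Mathlib

open Filter Topology
open scoped CStarAlgebra ComplexOrder

noncomputable section

namespace DiagDim

/-! ### C*-subalgebras, normalisers, matrix units -/

section Basic

variable {A : Type*} [NonUnitalCStarAlgebra A]

/-- The `*`-subalgebra `D` is abelian. -/
def IsAbelian (D : NonUnitalStarSubalgebra ℂ A) : Prop :=
  ∀ x ∈ D, ∀ y ∈ D, x * y = y * x

/-- `D` is a maximal abelian `*`-subalgebra of `A`. -/
def IsMasa (D : NonUnitalStarSubalgebra ℂ A) : Prop :=
  Maximal (fun E : NonUnitalStarSubalgebra ℂ A => IsAbelian E) D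

/-- The inclusion `D ⊆ A` is nondegenerate: `D` contains an approximate unit for `A`.
(A net `u` in `A` is recorded by its filter of tails.) -/
def IsNondegenerate [PartialOrder A] [StarOrderedRing A]
    (D : NonUnitalStarSubalgebra ℂ A) : Prop :=
  ∃ l : Filter A, l.IsIncreasingApproximateUnit ∧ ∀ᶠ u in l, u ∈ D

/-- The set `N_A(D)` of normalisers of `D` in `A`. -/
def normalisers (D : NonUnitalStarSubalgebra ℂ A) : Set A :=
  {a | ∀ d ∈ D, a * d * star a ∈ D ∧ star a * d * a ∈ D}

/-- `p` is a minimal projection of `D`: a nonzero projection in `D` whose only subprojections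
in `D` are `0` and `p`. -/
def IsMinimalProjection (D : NonUnitalStarSubalgebra ℂ A) (p : A) : Prop :=
  p ∈ D ∧ IsStarProjection p ∧ p ≠ 0 ∧
    ∀ q ∈ D, IsStarProjection q → p * q = q → q = 0 ∨ q = p

/-- `v` is a matrix unit with respect to `D`: both `v v*` and `v* v` are minimal projections
of `D`. -/
def IsMatrixUnit (D : NonUnitalStarSubalgebra ℂ A) (v : A) : Prop :=
  IsMinimalProjection D (v * star v) ∧ IsMinimalProjection D (star v * v)

/-- A map between C*-algebras is contractive. -/
def IsContractive {E E' : Type*} [Norm E] [Norm E'] (f : E → E') : Prop :=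
  ∀ x, ‖f x‖ ≤ ‖x‖

/-- The order zero condition (for a completely positive map): orthogonal positive elements are
sent to orthogonal elements. -/
def PreservesOrthogonality {E E' : Type*} [Mul E] [Zero E] [LE E] [Mul E'] [Zero E']
    (f : E → E') : Prop :=
  ∀ a a' : E, 0 ≤ a → 0 ≤ a' → a * a' = 0 → f a * f a' = 0

end Basic

/-! ### Diagonal dimension -/

section DiagonalDimension

variable {A : Type*} [NonUnitalCStarAlgebra A] [PartialOrder A] [StarOrderedRing A]

/-- `φ⁽ⁱ⁾`, the restriction of `φ` to the `i`-th direct summand. -/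
def summand {ι : Type*} [DecidableEq ι] {F : ι → Type*} [∀ i, Zero (F i)] {E : Type*}
    (φ : (∀ i, F i) → E) (i : ι) : F i → E :=
  fun x => φ (Pi.single i x)

/-- `(D ⊆ A)` has diagonal dimension at most `d`.  The finite-dimensional C*-algebra is
`F = F⁽⁰⁾ ⊕ ⋯ ⊕ F⁽ᵈ⁾` (with the maximum norm), and `DF i` is the masa `D⁽ⁱ⁾` of `F⁽ⁱ⁾`. -/
def DiagDimLE (D : NonUnitalStarSubalgebra ℂ A) (d : ℕ) : Prop :=
  ∀ (S : Finset A) (ε : ℝ), 0 < ε →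
    ∃ (F : Fin (d + 1) → Type) (_ : ∀ i, CStarAlgebra (F i)) (_ : ∀ i, PartialOrder (F i))
      (_ : ∀ i, StarOrderedRing (F i)) (_ : ∀ i, FiniteDimensional ℂ (F i))
      (DF : ∀ i, NonUnitalStarSubalgebra ℂ (F i))
      (ψ : A →CP (∀ i, F i)) (φ : (∀ i, F i) →CP A),
      (∀ i, IsMasa (DF i)) ∧
      IsContractive ψ ∧
      (∀ a ∈ S, ‖φ (ψ a) - a‖ < ε) ∧
      (∀ i, IsContractive (summand φ i) ∧ PreservesOrthogonality (summand φ i)) ∧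
      (∀ a ∈ D, ∀ i, ψ a i ∈ DF i) ∧
      (∀ i, ∀ v ∈ normalisers (DF i), summand φ i v ∈ normalisers D)

/-- The diagonal dimension of `(D ⊆ A)`: the least `d` with `DiagDimLE D d`, and `∞` if there
is none. -/
def diagDim (D : NonUnitalStarSubalgebra ℂ A) : ℕ∞ :=
  ⨅ (d : ℕ) (_ : DiagDimLE D d), (d : ℕ∞)

end DiagonalDimension

/-! ### Finite-dimensional C*-algebras with coefficients -/

section Coefficients

/-- `F ⊗ B = ⨁ⱼ M_{n j}(B)` for the finite-dimensional C*-algebra `F = ⨁ⱼ M_{n j}(ℂ)`;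
in particular `F` itself is `MatrixSum n ℂ`. -/
abbrev MatrixSum {m : ℕ} (n : Fin m → ℕ) (B : Type*) : Type _ :=
  ∀ j : Fin m, CStarMatrix (Fin (n j)) (Fin (n j)) B

/-- The elementary tensor `v ⊗ b` in `F ⊗ B`, i.e. the matrices with entries `v j k l • b`. -/
def tmul {m : ℕ} {n : Fin m → ℕ} {B : Type*} [SMul ℂ B] (v : MatrixSum n ℂ) (b : B) :
    MatrixSum n B :=
  fun j => CStarMatrix.ofMatrix (Matrix.of fun k l => v j k l • b)

/-- `D_F ⊗ B`, where `D_F` is the canonical diagonal of `F = ⨁ⱼ M_{n j}(ℂ)`: the tuples of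
diagonal matrices over `B`.  For `B = ℂ` this is `D_F`. -/
def canonicalDiagonal {m : ℕ} (n : Fin m → ℕ) (B : Type*) [NonUnitalCStarAlgebra B]
    [PartialOrder B] [StarOrderedRing B] : NonUnitalStarSubalgebra ℂ (MatrixSum n B) where
  carrier := {x | ∀ j k l, k ≠ l → x j k l = 0}
  add_mem' := fun {x y} hx hy j k l h => by
    simp [CStarMatrix.add_apply, hx j k l h, hy j k l h]
  zero_mem' := fun j k l _ => by simp
  mul_mem' := fun {x y} hx hy j k l h => by
    rw [Pi.mul_apply, CStarMatrix.mul_apply]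
    refine Finset.sum_eq_zero fun r _ => ?_
    by_cases hr : k = r
    · rw [hy j r l (hr ▸ h), mul_zero]
    · rw [hx j k r hr, zero_mul]
  smul_mem' := fun c x hx j k l h => by
    simp [CStarMatrix.smul_apply, hx j k l h]
  star_mem' := fun {x} hx j k l h => by
    rw [Pi.star_apply, CStarMatrix.star_apply, hx j l k h.symm, star_zero]

end Coefficients

/-! ### Multiplier algebras and supporting homomorphisms -/

section Supporting

variable {H : Type*} [NormedAddCommGroup H] [InnerProductSpace ℂ H] [CompleteSpace H]

/-- The multiplier algebra `M(C)` of a concrete C*-algebra `C` of operators on `H`, realised on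
the essential subspace `K = closure (C H)` of `C`: the operators `T` on `H` which live on `K`
(that is, `T` and `T*` vanish on `Kᗮ = {ξ | C ξ = 0}`) and which satisfy `T C ⊆ C` and
`C T ⊆ C`. -/
def multipliers (C : NonUnitalStarSubalgebra ℂ (H →L[ℂ] H)) : Set (H →L[ℂ] H) :=
  {T | (∀ c ∈ C, T * c ∈ C ∧ c * T ∈ C) ∧
    ∀ ξ : H, (∀ c ∈ C, c ξ = 0) → T ξ = 0 ∧ (star T) ξ = 0}

/-- The C*-algebra generated by the range of a map into `B(H)`. -/
def generatedCStar {E : Type*} (Φ : E → H →L[ℂ] H) : NonUnitalStarSubalgebra ℂ (H →L[ℂ] H) :=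
  (NonUnitalStarAlgebra.adjoin ℂ (Set.range Φ)).topologicalClosure

/-- `π` is a supporting `*`-homomorphism for the order zero map `Φ` on the C*-algebra `E` with
values in operators on `H`: with `C = C*(Φ(E))`, there is a positive `h ∈ M(C) ∩ C'` with
`‖h‖ = ‖Φ‖`, the map `π` takes its values in `M(C) ∩ {h}'`, and `Φ(a) = h π(a)` for all `a`. -/
def IsSupporting {E : Type*} [NonUnitalCStarAlgebra E] (Φ : E → H →L[ℂ] H)
    (π : E →⋆ₙₐ[ℂ] (H →L[ℂ] H)) : Prop :=
  ∃ h ∈ multipliers (generatedCStar Φ),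
    0 ≤ h ∧
    (∀ c ∈ generatedCStar Φ, h * c = c * h) ∧
    IsLeast {r : ℝ | 0 ≤ r ∧ ∀ a, ‖Φ a‖ ≤ r * ‖a‖} ‖h‖ ∧
    (∀ a, π a ∈ multipliers (generatedCStar Φ) ∧ π a * h = h * π a) ∧
    ∀ a, Φ a = h * π a

end Supporting

/-! ### Generalised diagonal dimension -/

section GeneralisedDiagonalDimension

variable {A : Type*} [NonUnitalCStarAlgebra A] [PartialOrder A] [StarOrderedRing A]
  {H : Type*} [NormedAddCommGroup H] [InnerProductSpace ℂ H] [CompleteSpace H]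

/-- For the C*-algebra `A`, concretely represented on `H` by `ρ`, the inclusion `(D ⊆ A)` has
generalised diagonal dimension with respect to `B` at most `d`.  Here
`F⁽ⁱ⁾ = ⨁ⱼ M_{n i j}(ℂ)` with canonical diagonal `D⁽ⁱ⁾`, and `F = F⁽⁰⁾ ⊕ ⋯ ⊕ F⁽ᵈ⁾`. In the last
condition the strong operator limit `L` of `π⁽ⁱ⁾(v ⊗ u)` along an approximate unit of `B` is
required to commute with `D`. -/
def GenDiagDimLE (ρ : A →⋆ₙₐ[ℂ] (H →L[ℂ] H)) (D : NonUnitalStarSubalgebra ℂ A)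
    (B : Type*) [NonUnitalCStarAlgebra B] [PartialOrder B] [StarOrderedRing B] (d : ℕ) : Prop :=
  ∀ (S : Finset A) (ε : ℝ), 0 < ε →
    ∃ (m : Fin (d + 1) → ℕ) (n : ∀ i, Fin (m i) → ℕ)
      (ψ : A →CP (∀ i, MatrixSum (n i) B)) (φ : (∀ i, MatrixSum (n i) B) →CP A),
      IsContractive ψ ∧
      (∀ a ∈ S, ‖φ (ψ a) - a‖ < ε) ∧
      (∀ i, IsContractive (summand φ i) ∧ PreservesOrthogonality (summand φ i)) ∧
      (∀ a ∈ D, ∀ i, ψ a i ∈ canonicalDiagonal (n i) B) ∧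
      (∀ i, (∀ x ∈ canonicalDiagonal (n i) B, summand φ i x ∈ normalisers D) ∧
        ∀ v, IsMatrixUnit (canonicalDiagonal (n i) ℂ) v →
          ∀ b : B, summand φ i (tmul v b) ∈ normalisers D) ∧
      (∀ i, ∀ π : MatrixSum (n i) B →⋆ₙₐ[ℂ] (H →L[ℂ] H),
        IsSupporting (fun x => ρ (summand φ i x)) π →
        ∀ l : Filter B, l.IsIncreasingApproximateUnit →
        ∀ v, IsMinimalProjection (canonicalDiagonal (n i) ℂ) v →
          ∃ L : H →L[ℂ] H, (∀ ξ : H, Tendsto (fun u => π (tmul v u) ξ) l (𝓝 (L ξ))) ∧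
            ∀ a ∈ D, L * ρ a = ρ a * L)

/-- The generalised diagonal dimension of `(D ⊆ A)` with respect to `B`: the least `d` with
`GenDiagDimLE ρ D B d`, and `∞` if there is none. -/
def genDiagDim (ρ : A →⋆ₙₐ[ℂ] (H →L[ℂ] H)) (D : NonUnitalStarSubalgebra ℂ A)
    (B : Type*) [NonUnitalCStarAlgebra B] [PartialOrder B] [StarOrderedRing B] : ℕ∞ :=
  ⨅ (d : ℕ) (_ : GenDiagDimLE ρ D B d), (d : ℕ∞)

end GeneralisedDiagonalDimension

end DiagDim

end

/-! For each `d` the two bounds `DiagDimLE D d` and `GenDiagDimLE ρ D ℂ d` are equivalent. For `B =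
ℂ` one has `F ⊗ B = F`, and a masa in a finite-dimensional C*-algebra is, up to isomorphism, the
canonical diagonal of a sum of matrix algebras (`exists_starAlgEquiv_of_isMasa`). Hence both
definitions use the same approximations, and only the conditions on normalisers and on supporting
homomorphisms have to be compared.

A fact used in both directions is that positive normalisers of `D` lie in `D`
(`mem_of_nonneg_of_mem_normalisers`). In particular, diagonal projections are mapped into `D`.

From generalised to ordinary: a normaliser `v` of the diagonal is a combination of matrix units with
at most one nonzero entry in each column. In the expansion of `φ(v) d φ(v)*`, order zero kills the
terms with different columns, the shape of `v` kills those with equal columns and different rows,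
and the remaining terms lie in `D` (`cp_mem_normalisers`).

From ordinary to generalised: diagonal elements and multiples of matrix units are normalisers. An
approximate unit of `ℂ` tends to `1`, so the strong limit is `π(v)`. Since `h = φ(1)` and `h π(v) =
φ(v)` are in the abelian algebra `D`, cancelling `h` shows that `π(v)` commutes with `D`
(`IsSupporting.commute`). -/

noncomputable section

namespace DiagDim

/-! ### Normalisers of a subalgebra -/

section Normalisers

variable {A : Type*} [NonUnitalCStarAlgebra A] {D : NonUnitalStarSubalgebra ℂ A}

theorem star_mem_normalisers {a : A} (ha : a ∈ normalisers D) : star a ∈ normalisers D :=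
  fun d hd => by simpa using (ha d hd).symm

theorem mem_normalisers_of_mem {a : A} (ha : a ∈ D) : a ∈ normalisers D := fun _ hd =>
  ⟨mul_mem (mul_mem ha hd) (star_mem ha), mul_mem (mul_mem (star_mem ha) hd) ha⟩

theorem smul_mem_normalisers {a : A} (ha : a ∈ normalisers D) (c : ℂ) :
    c • a ∈ normalisers D := fun d hd => by
  constructor
  · simpa [smul_mul_assoc, mul_smul_comm, smul_smul] using
      SMulMemClass.smul_mem (star c * c) (ha d hd).1
  · simpa [smul_mul_assoc, mul_smul_comm, smul_smul] using
      SMulMemClass.smul_mem (c * star c) (ha d hd).2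

theorem mem_normalisers_of_forall {s : Set A} (hs : ∀ a ∈ s, star a ∈ s)
    (h : ∀ a ∈ s, ∀ d ∈ D, a * d * star a ∈ D) {a : A} (ha : a ∈ s) : a ∈ normalisers D :=
  fun d hd => ⟨h a ha d hd, by simpa using h _ (hs a ha) d hd⟩

/-- A positive normaliser of a closed nondegenerate subalgebra belongs to the subalgebra. -/
theorem mem_of_nonneg_of_mem_normalisers [PartialOrder A] [StarOrderedRing A]
    (hclosed : IsClosed (D : Set A)) (hnondeg : IsNondegenerate D) {a : A} (ha : 0 ≤ a)
    (han : a ∈ normalisers D) : a ∈ D := by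
  obtain ⟨l, hl, hlD⟩ := hnondeg
  have := hl.neBot
  -- `a u a*` lies in `D` for `u` in the approximate unit and tends to `a²`; then `a` is the square
  -- root of an element of the closed algebra `D`.
  have hmul : a * a ∈ D := by
    have hlim : Tendsto (fun u => a * u * star a) l (𝓝 (a * a)) := by
      have := (hl.tendsto_mul_left a).mul_const (star a)
      rwa [(IsSelfAdjoint.of_nonneg ha).star_eq] at this ⊢
    exact hclosed.mem_of_tendsto hlim (hlD.mono fun u hu => (han u hu).1)
  have : IsClosed (D : Set A) := hclosed
  rw [← CFC.sqrt_mul_self a ha, CFC.sqrt_eq_real_sqrt (a * a) (IsSelfAdjoint.of_nonneg ha).mul_self_nonneg]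
  exact cfcₙ_mem _ hmul

end Normalisers

/-! ### Annihilators and completely positive maps -/

section CompletelyPositive

variable {A₁ A₂ : Type*} [CStarAlgebra A₁] [PartialOrder A₁] [StarOrderedRing A₁]
  [NonUnitalCStarAlgebra A₂] [PartialOrder A₂] [StarOrderedRing A₂]

theorem exists_eq_star_mul_self {a : A₂} (ha : 0 ≤ a) : ∃ s, a = star s * s :=
  CStarAlgebra.nonneg_iff_eq_star_mul_self.1 ha

theorem mul_eq_zero_of_star_mul_mul_eq_zero {ι : Type*} [Fintype ι] (s : ι → A₂) (c : A₂)
    (h : (∑ i, star (s i) * s i) * c = 0) (i : ι) : s i * c = 0 := by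
  have hsum : ∑ i, star (s i * c) * (s i * c) = 0 := by
    have : ∑ i, star (s i * c) * (s i * c) = star c * ((∑ i, star (s i) * s i) * c) := by
      simp [Finset.sum_mul, Finset.mul_sum, mul_assoc]
    rw [this, h, mul_zero]
  have := (Finset.sum_eq_zero_iff_of_nonneg fun i _ => star_mul_self_nonneg (s i * c)).1 hsum i
    (Finset.mem_univ i)
  exact CStarRing.star_mul_self_eq_zero_iff _ |>.1 this

/-- If `φ (x⋆ x)` annihilates `c`, so does `φ x`. -/
theorem cp_mul_eq_zero (φ : A₁ →CP A₂) (x : A₁) {c : A₂}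
    (h : φ (star x * x) * c = 0) : φ x * c = 0 := by
  -- `N* N = [1, x; x*, x* x]`, so its image under the second amplification of `φ` is some `S* S`.
  -- The second column of `S` gives `φ(x* x)` and is a right factor in `φ(x)`.
  let N : CStarMatrix (Fin 2) (Fin 2) A₁ := CStarMatrix.ofMatrix !![1, x; 0, 0]
  have hP := φ.map_cstarMatrix_nonneg (star N * N) (star_mul_self_nonneg N)
  obtain ⟨S, hS⟩ := exists_eq_star_mul_self hP
  have e11 : φ (star x * x) = ∑ i, star (S i 1) * S i 1 := by
    have := congrFun (congrFun hS 1) 1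
    simpa [N, CStarMatrix.mul_apply, CStarMatrix.star_apply] using this
  have e01 : φ x = ∑ i, star (S i 0) * S i 1 := by
    have := congrFun (congrFun hS 0) 1
    simpa [N, CStarMatrix.mul_apply, CStarMatrix.star_apply] using this
  rw [e11] at h
  rw [e01, Finset.sum_mul]
  refine Finset.sum_eq_zero fun i _ => ?_
  rw [mul_assoc, mul_eq_zero_of_star_mul_mul_eq_zero (fun i => S i 1) c h i, mul_zero]

theorem cp_map_star {E E' : Type*} [NonUnitalCStarAlgebra E] [PartialOrder E] [StarOrderedRing E]
    [NonUnitalCStarAlgebra E'] [PartialOrder E'] [StarOrderedRing E'] (φ : E →CP E') (x : E) :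
    φ (star x) = star (φ x) := by
  exact map_star φ x

end CompletelyPositive

/-! ### Supporting homomorphisms of order zero maps -/

section Supporting

variable {H : Type*} [NormedAddCommGroup H] [InnerProductSpace ℂ H] [CompleteSpace H]

theorem mul_eq_zero_of_mem_generatedCStar {E : Type*} {Φ : E → H →L[ℂ] H} {T : H →L[ℂ] H}
    (h : ∀ a, Φ a * T = 0) (h' : ∀ a, star (Φ a) * T = 0) {c : H →L[ℂ] H}
    (hc : c ∈ generatedCStar Φ) : c * T = 0 := by
  have hadj : ∀ c ∈ NonUnitalStarAlgebra.adjoin ℂ (Set.range Φ), c * T = 0 := by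
    intro c hc
    change c ∈ NonUnitalAlgebra.adjoin ℂ (Set.range Φ ∪ star (Set.range Φ)) at hc
    induction hc using NonUnitalAlgebra.adjoin_induction with
    | mem x hx =>
      rcases hx with ⟨a, rfl⟩ | ⟨a, ha⟩
      · exact h a
      · rw [← star_star x, ← ha]; exact h' a
    | add x y _ _ hx hy => rw [add_mul, hx, hy, add_zero]
    | zero => exact zero_mul T
    | mul x y _ _ _ hy => rw [mul_assoc, hy, mul_zero]
    | smul r x _ hx => rw [smul_mul_assoc, hx, smul_zero]
  have hcl : IsClosed {c : H →L[ℂ] H | c * T = 0} :=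
    isClosed_eq (continuous_id.mul continuous_const) continuous_const
  exact closure_minimal (fun c hc => hadj c hc) hcl hc

/-- The last two clauses say that `h` and the range of `π` annihilate the same operators `T`. Either
kind of annihilation gives `Φ(a) T = 0` and `Φ(a)* T = 0`, hence `C T = 0`; the range of `T` then
lies in the common kernel of `C`, where all multipliers vanish. -/
theorem IsSupporting.exists_apply_eq {E : Type*} [NonUnitalCStarAlgebra E] {Φ : E → H →L[ℂ] H}
    {π : E →⋆ₙₐ[ℂ] (H →L[ℂ] H)} (hπ : IsSupporting Φ π) :
    ∃ h : H →L[ℂ] H, IsSelfAdjoint h ∧ (∀ a, Φ a = h * π a) ∧ (∀ a, h * π a = π a * h) ∧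
      (∀ T : H →L[ℂ] H, h * T = 0 → ∀ a, π a * T = 0) ∧
      ∀ T : H →L[ℂ] H, (∀ a, π a * T = 0) → h * T = 0 := by
  obtain ⟨h, hM, h0, -, -, hπM, hΦ⟩ := hπ
  have hsa : IsSelfAdjoint h := .of_nonneg h0
  have hcomm : ∀ a, h * π a = π a * h := fun a => ((hπM a).2).symm
  have hΦ' : ∀ a, Φ a = π a * h := fun a => (hΦ a).trans (hcomm a)
  have hstar : ∀ a, star (Φ a) = π (star a) * h := fun a => by
    rw [hΦ a, star_mul, hsa.star_eq, map_star]
  refine ⟨h, hsa, hΦ, hcomm, fun T hT a => ?_, fun T hT => ?_⟩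
  · ext ξ
    refine ((hπM a).1.2 (T ξ) fun c hc => ?_).1
    exact DFunLike.congr_fun (mul_eq_zero_of_mem_generatedCStar (T := T)
      (fun a => by rw [hΦ', mul_assoc, hT, mul_zero])
      (fun a => by rw [hstar, mul_assoc, hT, mul_zero]) hc) ξ
  · ext ξ
    refine (hM.2 (T ξ) fun c hc => ?_).1
    exact DFunLike.congr_fun (mul_eq_zero_of_mem_generatedCStar (T := T)
      (fun a => by rw [hΦ, mul_assoc, hT, mul_zero])
      (fun a => by rw [hstar, ← hcomm, mul_assoc, hT, mul_zero]) hc) ξ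

/-- An operator commuting with `Φ 1` and `Φ p`, for a projection `p`, commutes with `π p`. -/
theorem IsSupporting.commute {E : Type*} [CStarAlgebra E] {Φ : E → H →L[ℂ] H}
    {π : E →⋆ₙₐ[ℂ] (H →L[ℂ] H)} (hπ : IsSupporting Φ π) {p : E} (hp : IsStarProjection p)
    {T : H →L[ℂ] H} (h1 : Commute (Φ 1) T) (hT : Commute (Φ p) T) : Commute (π p) T := by
  obtain ⟨h, hsa, hΦ, hcomm, hker, hker'⟩ := hπ.exists_apply_eq
  -- `1 - π(1)` is annihilated by every `π(a)`, hence by `h`.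
  have hh : Φ 1 = h := by
    have : h * (1 - π 1) = 0 := hker' _ fun a => by rw [mul_sub, ← map_mul, mul_one, mul_one, sub_self]
    rw [mul_sub, mul_one, sub_eq_zero] at this
    rw [hΦ, ← this]
  rw [hh] at h1
  have hpp : π p * π p = π p := by rw [← map_mul, hp.isIdempotentElem.eq]
  have hps : star (π p) = π p := by rw [← map_star, hp.isSelfAdjoint.star_eq]
  -- `h` annihilates `π(p) R - R π(p)`, so `π(p)` does too. Applying this to `T` and to `T*` yields
  -- `π(p) T = π(p) T π(p) = T π(p)`.
  have key : ∀ R : H →L[ℂ] H, Commute h R → Commute (Φ p) R → π p * R = π p * R * π p := by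
    intro R hR hpR
    have : h * (π p * R - R * π p) = 0 := by
      rw [mul_sub, ← mul_assoc, ← hΦ, ← mul_assoc, hR.eq, mul_assoc, ← hΦ, hpR.eq, sub_self]
    have := hker _ this p
    rwa [mul_sub, ← mul_assoc, hpp, ← mul_assoc, sub_eq_zero] at this
  have hΦs : star (Φ p) = Φ p := by rw [hΦ, star_mul, hps, hsa.star_eq, hcomm]
  have k1 := key T h1 hT
  have k2 := congrArg star (key (star T) (by simpa [hsa.star_eq] using h1.star_star)
    (by simpa [hΦs] using hT.star_star))
  simp only [star_mul, star_star, hps] at k2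
  rw [commute_iff_eq, k1, k2, mul_assoc]

end Supporting

/-! ### Compositions and restrictions of completely positive maps -/

section CompletelyPositive

variable {A₁ A₂ A₃ : Type*} [NonUnitalCStarAlgebra A₁] [PartialOrder A₁] [StarOrderedRing A₁]
  [NonUnitalCStarAlgebra A₂] [PartialOrder A₂] [StarOrderedRing A₂]
  [NonUnitalCStarAlgebra A₃] [PartialOrder A₃] [StarOrderedRing A₃]

/-- The composition of completely positive maps. -/
def cpComp (g : A₂ →CP A₃) (f : A₁ →CP A₂) : A₁ →CP A₃ where
  toLinearMap := (g : A₂ →ₗ[ℂ] A₃) ∘ₗ (f : A₁ →ₗ[ℂ] A₂)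
  map_cstarMatrix_nonneg' _ M hM :=
    g.map_cstarMatrix_nonneg (M.map f) (f.map_cstarMatrix_nonneg M hM)

/-- A `*`-homomorphism, as a completely positive map. -/
def cpOfHom (f : A₁ →⋆ₙₐ[ℂ] A₂) : A₁ →CP A₂ :=
  CompletelyPositiveMapClass.toCompletelyPositiveLinearMap f

/-- The inclusion of a direct summand. -/
def singleHom {ι : Type*} [DecidableEq ι] (F : ι → Type*) [∀ i, NonUnitalCStarAlgebra (F i)]
    (i : ι) : F i →⋆ₙₐ[ℂ] (∀ i, F i) where
  toFun := Pi.single i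
  map_smul' c x := Pi.single_smul i c x
  map_zero' := Pi.single_zero i
  map_add' := Pi.single_add i
  map_mul' := Pi.single_mul i
  map_star' x := by
    ext j
    by_cases h : j = i
    · subst h; simp
    · simp [h]

/-- The restriction of a completely positive map to a direct summand. -/
def cpSummand {ι : Type*} [Fintype ι] [DecidableEq ι] {F : ι → Type*}
    [∀ i, NonUnitalCStarAlgebra (F i)]
    [∀ i, PartialOrder (F i)] [∀ i, StarOrderedRing (F i)] (φ : (∀ i, F i) →CP A₃) (i : ι) :
    F i →CP A₃ :=
  cpComp φ (cpOfHom (singleHom F i))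

theorem coe_cpSummand {ι : Type*} [Fintype ι] [DecidableEq ι] {F : ι → Type*}
    [∀ i, NonUnitalCStarAlgebra (F i)]
    [∀ i, PartialOrder (F i)] [∀ i, StarOrderedRing (F i)] (φ : (∀ i, F i) →CP A₃) (i : ι) :
    ⇑(cpSummand φ i) = summand φ i := rfl

end CompletelyPositive

/-! ### Matrix units and normalisers of the canonical diagonal -/

section MatrixUnits

variable {m : ℕ} {n : Fin m → ℕ}

/-- The standard matrix units of `⨁ⱼ M_{n j}(ℂ)`. -/
def matUnit (j : Fin m) (k l : Fin (n j)) : MatrixSum n ℂ :=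
  Pi.single j (CStarMatrix.ofMatrix (Matrix.single k l 1))

@[simp]
theorem matUnit_apply_same (j : Fin m) (k l a b : Fin (n j)) :
    matUnit j k l j a b = if k = a ∧ l = b then 1 else 0 := by
  simp [matUnit, Matrix.single, CStarMatrix.ofMatrix_apply]

theorem matUnit_apply_ne {j j' : Fin m} (h : j' ≠ j) (k l : Fin (n j)) (a b : Fin (n j')) :
    matUnit j k l j' a b = 0 := by
  simp [matUnit, h]

theorem mul_entry (x y : MatrixSum n ℂ) (j : Fin m) (a b : Fin (n j)) :
    (x * y) j a b = ∑ r, x j a r * y j r b := by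
  rw [Pi.mul_apply, CStarMatrix.mul_apply]

theorem star_entry (x : MatrixSum n ℂ) (j : Fin m) (a b : Fin (n j)) :
    (star x) j a b = star (x j b a) := by
  rw [Pi.star_apply, CStarMatrix.star_apply]

theorem matrixSum_ext {x y : MatrixSum n ℂ} (h : ∀ j a b, x j a b = y j a b) : x = y :=
  funext fun j => CStarMatrix.ext (h j)

theorem matUnit_mul_apply_same (j : Fin m) (k l a b : Fin (n j)) (x : MatrixSum n ℂ) :
    (matUnit j k l * x) j a b = if k = a then x j l b else 0 := by
  rw [mul_entry]
  by_cases h : k = a <;> simp [h]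

theorem matUnit_mul_apply_ne {j j' : Fin m} (h : j' ≠ j) (k l : Fin (n j)) (a b : Fin (n j'))
    (x : MatrixSum n ℂ) : (matUnit j k l * x) j' a b = 0 := by
  rw [mul_entry]
  exact Finset.sum_eq_zero fun r _ => by rw [matUnit_apply_ne h, zero_mul]

theorem mul_matUnit_apply_same (j : Fin m) (k l a b : Fin (n j)) (x : MatrixSum n ℂ) :
    (x * matUnit j k l) j a b = if l = b then x j a k else 0 := by
  rw [mul_entry]
  by_cases h : l = b <;> simp [h]

theorem star_matUnit (j : Fin m) (k l : Fin (n j)) :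
    star (matUnit j k l) = matUnit j l k := by
  refine matrixSum_ext fun j' a b => ?_
  rw [star_entry]
  by_cases h : j' = j
  · subst h
    simp only [matUnit_apply_same, and_comm]
    split_ifs <;> simp
  · simp [matUnit_apply_ne h]

theorem matUnit_mul_matUnit (j : Fin m) (k l r : Fin (n j)) :
    matUnit j k l * matUnit j l r = matUnit j k r := by
  refine matrixSum_ext fun j' a b => ?_
  by_cases h : j' = j
  · subst h
    rw [matUnit_mul_apply_same]
    by_cases hk : k = a <;> simp [hk]
  · rw [matUnit_mul_apply_ne h, matUnit_apply_ne h]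

theorem matUnit_mul_matUnit_of_ne {j j' : Fin m} {k l : Fin (n j)} {k' l' : Fin (n j')}
    (h : (⟨j, l⟩ : Σ j, Fin (n j)) ≠ ⟨j', k'⟩) : matUnit j k l * matUnit j' k' l' = 0 := by
  refine matrixSum_ext fun i a b => ?_
  by_cases hi : i = j
  · subst hi
    rw [matUnit_mul_apply_same]
    by_cases hj : i = j'
    · subst hj
      have : k' ≠ l := fun e => h (by rw [e])
      simp [this]
    · simp [matUnit_apply_ne hj]
  · rw [matUnit_mul_apply_ne hi]; rfl

theorem isStarProjection_matUnit (j : Fin m) (k : Fin (n j)) :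
    IsStarProjection (matUnit j k k) :=
  ⟨matUnit_mul_matUnit j k k k, star_matUnit j k k⟩

theorem matUnit_ne_zero (j : Fin m) (k l : Fin (n j)) : matUnit j k l ≠ 0 := fun h => by
  have : matUnit j k l j k l = 0 := by rw [h]; rfl
  simp at this

theorem matUnit_self_mem (j : Fin m) (k : Fin (n j)) :
    matUnit j k k ∈ canonicalDiagonal n ℂ := fun j' a b hab => by
  by_cases h : j' = j
  · subst h
    rw [matUnit_apply_same, if_neg fun h => hab (h.1.symm.trans h.2)]
  · exact matUnit_apply_ne h k k a b

theorem matUnit_mul_of_mem {x : MatrixSum n ℂ} (hx : x ∈ canonicalDiagonal n ℂ) (j : Fin m)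
    (k : Fin (n j)) : matUnit j k k * x = x j k k • matUnit j k k := by
  refine matrixSum_ext fun j' a b => ?_
  by_cases h : j' = j
  · subst h
    rw [matUnit_mul_apply_same, Pi.smul_apply, CStarMatrix.smul_apply, matUnit_apply_same]
    by_cases hka : k = a
    · subst hka
      by_cases hkb : k = b
      · subst hkb; simp
      · simp [hkb, hx j' k b hkb]
    · simp [hka]
  · rw [matUnit_mul_apply_ne h, Pi.smul_apply, CStarMatrix.smul_apply, matUnit_apply_ne h, smul_zero]

theorem isAbelian_canonicalDiagonal : IsAbelian (canonicalDiagonal n ℂ) := fun x hx y hy => by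
  refine matrixSum_ext fun j a b => ?_
  rw [mul_entry, mul_entry]
  refine Finset.sum_congr rfl fun r _ => ?_
  by_cases har : a = r
  · subst har
    by_cases hab : a = b
    · subst hab; exact mul_comm _ _
    · rw [hx j a b hab, hy j a b hab, mul_zero, mul_zero]
  · rw [hx j a r har, hy j a r har, zero_mul, zero_mul]

theorem isMasa_canonicalDiagonal : IsMasa (canonicalDiagonal n ℂ) := by
  refine ⟨isAbelian_canonicalDiagonal, fun E hE hle x hx j k l hkl => ?_⟩
  have := congrFun (congrFun (congrFun (hE _ (hle (matUnit_self_mem j k)) x hx) j) k) l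
  rw [matUnit_mul_apply_same, mul_matUnit_apply_same] at this
  simpa [hkl] using this

theorem isMinimalProjection_matUnit (j : Fin m) (k : Fin (n j)) :
    IsMinimalProjection (canonicalDiagonal n ℂ) (matUnit j k k) := by
  refine ⟨matUnit_self_mem j k, isStarProjection_matUnit j k, matUnit_ne_zero j k k,
    fun q hq hqp hle => ?_⟩
  rw [matUnit_mul_of_mem hq] at hle
  have hqq := hqp.isIdempotentElem.eq
  rw [← hle, smul_mul_smul_comm, matUnit_mul_matUnit] at hqq
  have := congrFun (congrFun (congrFun hqq j) k) k
  simp only [Pi.smul_apply, CStarMatrix.smul_apply, matUnit_apply_same, and_self, if_true,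
    smul_eq_mul, mul_one] at this
  rcases mul_eq_left₀' this with h | h
  · left; rw [← hle, h, zero_smul]
  · right; rw [← hle, h, one_smul]
where
  mul_eq_left₀' {c : ℂ} (h : c * c = c) : c = 0 ∨ c = 1 := by
    rcases eq_or_ne c 0 with h0 | h0
    · exact .inl h0
    · exact .inr (mul_left_cancel₀ h0 (by rw [h, mul_one]))

theorem isMatrixUnit_matUnit (j : Fin m) (k l : Fin (n j)) :
    IsMatrixUnit (canonicalDiagonal n ℂ) (matUnit j k l) := by
  rw [IsMatrixUnit, star_matUnit, matUnit_mul_matUnit, matUnit_mul_matUnit]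
  exact ⟨isMinimalProjection_matUnit j k, isMinimalProjection_matUnit j l⟩

/-- Some diagonal entry of `p` is nonzero, hence `1` by idempotency. The corresponding diagonal
matrix unit is then a subprojection of `p`, and minimality forces equality. -/
theorem IsMinimalProjection.exists_eq_matUnit {p : MatrixSum n ℂ}
    (hp : IsMinimalProjection (canonicalDiagonal n ℂ) p) : ∃ j k, p = matUnit j k k := by
  obtain ⟨hpD, hpp, hp0, hmin⟩ := hp
  obtain ⟨j, k, hjk⟩ : ∃ j k, p j k k ≠ 0 := by
    by_contra! h
    refine hp0 (matrixSum_ext fun j a b => ?_)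
    rcases eq_or_ne a b with rfl | hab
    · exact h j a
    · exact hpD j a b hab
  have hcomm := isAbelian_canonicalDiagonal _ hpD _ (matUnit_self_mem j k)
  have hmul := matUnit_mul_of_mem hpD j k
  have h1 : p j k k = 1 := by
    have := congrFun (congrFun (congrFun hpp.isIdempotentElem.eq j) k) k
    rw [mul_entry, Finset.sum_eq_single k] at this
    · exact mul_left_cancel₀ hjk (by rw [this, mul_one])
    · intro r _ hr; rw [hpD j k r hr.symm, zero_mul]
    · simp
  rw [h1, one_smul] at hmul
  refine ⟨j, k, ?_⟩
  rcases hmin _ (matUnit_self_mem j k) (isStarProjection_matUnit j k) (hcomm.trans hmul) with h | h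
  · exact absurd h (matUnit_ne_zero j k k)
  · exact h.symm

/-- The corner cut out by a diagonal matrix unit consists of its scalar multiples. -/
theorem IsMinimalProjection.mul_mul_mem {p : MatrixSum n ℂ}
    (hp : IsMinimalProjection (canonicalDiagonal n ℂ) p) (x : MatrixSum n ℂ) :
    p * x * p ∈ canonicalDiagonal n ℂ := by
  obtain ⟨j, k, rfl⟩ := hp.exists_eq_matUnit
  intro j' a b hab
  by_cases h : j' = j
  · subst h
    rw [mul_matUnit_apply_same, matUnit_mul_apply_same]
    by_cases hb : k = b
    · rw [if_neg fun ha : k = a => hab (ha.symm.trans hb), ite_self]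
    · rw [if_neg hb]
  · rw [mul_assoc, matUnit_mul_apply_ne h]

/-- With `q = v* v` and `w = v v* v - v`, one has `w* w = q³ - 2q² + q = 0`. -/
theorem mul_star_mul_self {E : Type*} [NonUnitalCStarAlgebra E] {v : E}
    (h : IsStarProjection (star v * v)) : v * star v * v = v := by
  have h2 := h.isIdempotentElem.eq
  rw [← sub_eq_zero, ← CStarRing.star_mul_self_eq_zero_iff]
  have : star (v * star v * v - v) * (v * star v * v - v)
      = (star v * v * (star v * v)) * (star v * v) - star v * v * (star v * v)
        - (star v * v * (star v * v)) + star v * v := by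
    simp only [star_sub, star_mul, star_star]
    noncomm_ring
  rw [this, h2, h2]
  abel

/-- A matrix unit with respect to the canonical diagonal normalises it. -/
theorem IsMatrixUnit.mem_normalisers {v : MatrixSum n ℂ}
    (hv : IsMatrixUnit (canonicalDiagonal n ℂ) v) :
    v ∈ normalisers (canonicalDiagonal n ℂ) := fun d _ => by
  have h1 := mul_star_mul_self hv.2.2.1
  have h2 := congrArg star h1
  simp only [star_mul, star_star] at h2
  constructor
  · have := hv.1.mul_mul_mem (v * d * star v)
    rwa [show v * star v * (v * d * star v) * (v * star v)
      = (v * star v * v) * d * (star v * (v * star v)) by noncomm_ring, h1, h2] at this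
  · have := hv.2.mul_mul_mem (star v * d * v)
    rwa [show star v * v * (star v * d * v) * (star v * v)
      = (star v * (v * star v)) * d * (v * star v * v) by noncomm_ring, h1, h2] at this

theorem eq_sum_matUnit (x : MatrixSum n ℂ) :
    x = ∑ p : (Σ j : Fin m, Fin (n j) × Fin (n j)), x p.1 p.2.1 p.2.2 • matUnit p.1 p.2.1 p.2.2 := by
  refine matrixSum_ext fun j a b => ?_
  have happ : ∀ (f : (Σ j : Fin m, Fin (n j) × Fin (n j)) → MatrixSum n ℂ),
      (∑ p, f p) j a b = ∑ p, f p j a b := fun f => by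
    rw [Finset.sum_apply]
    exact map_sum (⟨⟨fun M : CStarMatrix (Fin (n j)) (Fin (n j)) ℂ => M a b, rfl⟩,
      fun _ _ => rfl⟩ : CStarMatrix (Fin (n j)) (Fin (n j)) ℂ →+ ℂ) _ _
  rw [happ, Finset.sum_eq_single ⟨j, a, b⟩]
  · simp
  · rintro ⟨j', k, l⟩ _ hne
    simp only [Pi.smul_apply, CStarMatrix.smul_apply]
    by_cases h : j = j'
    · subst h
      have : ¬ (k = a ∧ l = b) := fun h => hne (by rw [h.1, h.2])
      simp [this]
    · rw [matUnit_apply_ne h, smul_zero]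
  · simp

/-- The product is the off-diagonal `(k, k')` entry of `v e v*`, where `e` is the `l`-th diagonal
matrix unit of block `j`. Thus each column of a normaliser has at most one nonzero entry. -/
theorem star_mem_normalisers_entry {v : MatrixSum n ℂ}
    (hv : v ∈ normalisers (canonicalDiagonal n ℂ)) (j : Fin m) {k k' : Fin (n j)} (h : k ≠ k')
    (l : Fin (n j)) : v j k l * star (v j k' l) = 0 := by
  have := (hv _ (matUnit_self_mem j l)).1 j k k' h
  rw [mul_entry, Finset.sum_eq_single l] at this
  · rwa [mul_matUnit_apply_same, if_pos rfl, star_entry] at this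
  · intro r _ hr
    rw [mul_matUnit_apply_same, if_neg hr.symm, zero_mul]
  · simp

variable {A : Type*} [NonUnitalCStarAlgebra A] [PartialOrder A] [StarOrderedRing A]
  {D : NonUnitalStarSubalgebra ℂ A}

/-- A completely positive order zero map which sends the matrix units to normalisers of an abelian
subalgebra `D`, and the diagonal ones into `D`, sends normalisers to normalisers. -/
theorem cp_mem_normalisers (hD : IsAbelian D) (φ : MatrixSum n ℂ →CP A)
    (hφ : PreservesOrthogonality φ) (hdiag : ∀ j l, φ (matUnit j l l) ∈ D)
    (hunit : ∀ j k l, φ (matUnit j k l) ∈ normalisers D) {v : MatrixSum n ℂ}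
    (hv : v ∈ normalisers (canonicalDiagonal n ℂ)) : φ v ∈ normalisers D := by
  -- Terms with distinct columns vanish. Order zero makes the images of the two source projections
  -- orthogonal, `d` is moved past one of them because `D` is abelian, and `cp_mul_eq_zero`, applied
  -- on each side in turn, replaces these projections by the matrix units.
  have horth : ∀ (j j' : Fin m) (k l : Fin (n j)) (k' l' : Fin (n j')),
      (⟨j, l⟩ : Σ j, Fin (n j)) ≠ ⟨j', l'⟩ → ∀ d ∈ D,
      φ (matUnit j k l) * d * star (φ (matUnit j' k' l')) = 0 := by
    intro j j' k l k' l' hne d hd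
    have h0 : φ (matUnit j l l) * φ (matUnit j' l' l') = 0 :=
      hφ _ _ (isStarProjection_matUnit j l).nonneg (isStarProjection_matUnit j' l').nonneg
        (matUnit_mul_matUnit_of_ne hne)
    have hs : star (φ (matUnit j' l' l')) = φ (matUnit j' l' l') := by
      rw [← cp_map_star, star_matUnit]
    have h1 : φ (matUnit j k l) * (d * φ (matUnit j' l' l')) = 0 := by
      refine cp_mul_eq_zero φ _ ?_
      rw [star_matUnit, matUnit_mul_matUnit, hD d hd _ (hdiag j' l'), ← mul_assoc, h0, zero_mul]
    have h2 : φ (matUnit j' k' l') * star (φ (matUnit j k l) * d) = 0 := by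
      refine cp_mul_eq_zero φ _ ?_
      rw [star_matUnit, matUnit_mul_matUnit, ← hs, ← star_mul, mul_assoc, h1, star_zero]
    have := congrArg star h2
    rwa [star_mul, star_star, star_zero] at this
  refine mem_normalisers_of_forall (s := φ '' normalisers (canonicalDiagonal n ℂ)) ?_ ?_
    ⟨v, hv, rfl⟩
  · rintro _ ⟨v, hv, rfl⟩
    exact ⟨star v, star_mem_normalisers hv, cp_map_star φ v⟩
  · rintro _ ⟨v, hv, rfl⟩ d hd
    rw [eq_sum_matUnit v, map_sum, star_sum, Finset.sum_mul, Finset.sum_mul_sum]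
    refine sum_mem fun p _ => sum_mem fun q _ => ?_
    obtain ⟨j, k, l⟩ := p
    obtain ⟨j', k', l'⟩ := q
    simp only [map_smul, star_smul, smul_mul_assoc, mul_smul_comm]
    by_cases hne : (⟨j, l⟩ : Σ j, Fin (n j)) = ⟨j', l'⟩
    · obtain ⟨rfl, hl⟩ := Sigma.mk.inj_iff.1 hne
      obtain rfl := eq_of_heq hl
      rw [smul_smul]
      by_cases hk : k = k'
      · subst hk
        exact SMulMemClass.smul_mem _ (hunit j k l d hd).1
      · have := star_mem_normalisers_entry hv j hk l
        rw [mul_comm, this, zero_smul]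
        exact zero_mem D
    · rw [horth j j' k l k' l' hne d hd, smul_zero, smul_zero]
      exact zero_mem D

end MatrixUnits

/-! ### Matrix units built from partial isometries -/

section Frames

variable {m : ℕ} {n : Fin m → ℕ} {F : Type*} [CStarAlgebra F]

/-- A family of partial isometries whose range projections are minimal, orthogonal and sum up to
one, indexed in such a way that equivalent projections have indices in the same block. -/
structure IsFrame (W : (Σ j, Fin (n j)) → F) : Prop where
  orthogonal : ∀ a b, a ≠ b → star (W a) * W b = 0
  ne_zero : ∀ a, W a ≠ 0
  star_mul_self_eq : ∀ j k l, star (W ⟨j, k⟩) * W ⟨j, k⟩ = star (W ⟨j, l⟩) * W ⟨j, l⟩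
  mul_star_mul : ∀ a, W a * star (W a) * W a = W a
  sum_eq_one : ∑ a, W a * star (W a) = 1
  mul_eq_zero : ∀ a b, a.1 ≠ b.1 → ∀ x, star (W a) * x * W b = 0
  corner : ∀ a x, ∃ c : ℂ, W a * star (W a) * x * (W a * star (W a)) = c • (W a * star (W a))

variable {W : (Σ j, Fin (n j)) → F}

/-- The linear map sending the standard matrix units to the ones defined by a frame. -/
def frameMap (W : (Σ j, Fin (n j)) → F) : MatrixSum n ℂ →ₗ[ℂ] F where
  toFun x := ∑ p : (Σ j : Fin m, Fin (n j) × Fin (n j)),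
    x p.1 p.2.1 p.2.2 • (W ⟨p.1, p.2.1⟩ * star (W ⟨p.1, p.2.2⟩))
  map_add' x y := by simp [add_smul, Finset.sum_add_distrib]
  map_smul' c x := by simp [smul_smul, Finset.smul_sum]

theorem frameMap_apply (x : MatrixSum n ℂ) :
    frameMap W x = ∑ p : (Σ j : Fin m, Fin (n j) × Fin (n j)),
      x p.1 p.2.1 p.2.2 • (W ⟨p.1, p.2.1⟩ * star (W ⟨p.1, p.2.2⟩)) := rfl

namespace IsFrame

/-- The range projections sum to one, so the compressions `W_a* y W_b` determine `y`. For `frameMap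
W x` they are the entries of `x` times the source projections, which reduces every identity below to
matrix entries. -/
theorem ext (hW : IsFrame W) {y z : F} (h : ∀ a b, star (W a) * y * W b = star (W a) * z * W b) :
    y = z := by
  have key : ∀ y : F, y = ∑ a, ∑ b, W a * (star (W a) * y * W b) * star (W b) := fun y => by
    calc y = (∑ a, W a * star (W a)) * y * (∑ b, W b * star (W b)) := by
          rw [hW.sum_eq_one, one_mul, mul_one]
      _ = _ := by
          rw [Finset.sum_mul, Finset.sum_mul_sum]
          simp only [mul_assoc]
  rw [key y, key z]
  simp only [h]

theorem source_ne_zero (hW : IsFrame W) (a : Σ j, Fin (n j)) : star (W a) * W a ≠ 0 := fun h =>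
  hW.ne_zero a (CStarRing.star_mul_self_eq_zero_iff _ |>.1 h)

theorem source_mul_source (hW : IsFrame W) (a : Σ j, Fin (n j)) :
    star (W a) * W a * (star (W a) * W a) = star (W a) * W a := by
  rw [mul_assoc, ← mul_assoc (W a), hW.mul_star_mul]

theorem star_mul_frameMap_mul_of_ne (hW : IsFrame W) (x : MatrixSum n ℂ) {a b : Σ j, Fin (n j)}
    (h : a.1 ≠ b.1) : star (W a) * frameMap W x * W b = 0 :=
  hW.mul_eq_zero a b h _

theorem star_mul_frameMap_mul (hW : IsFrame W) (x : MatrixSum n ℂ) (j : Fin m) (k l : Fin (n j)) :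
    star (W ⟨j, k⟩) * frameMap W x * W ⟨j, l⟩ = x j k l • (star (W ⟨j, k⟩) * W ⟨j, k⟩) := by
  rw [frameMap_apply, Finset.mul_sum, Finset.sum_mul, Finset.sum_eq_single ⟨j, k, l⟩]
  · rw [mul_smul_comm, smul_mul_assoc, ← mul_assoc, mul_assoc, hW.star_mul_self_eq j l k,
      hW.source_mul_source]
  · rintro ⟨j', k', l'⟩ _ hne
    rw [mul_smul_comm, smul_mul_assoc, ← mul_assoc, mul_assoc]
    by_cases h : (⟨j, k⟩ : Σ j, Fin (n j)) = ⟨j', k'⟩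
    · obtain ⟨rfl, hk⟩ := Sigma.mk.inj_iff.1 h
      obtain rfl := eq_of_heq hk
      have hl : (⟨j, l'⟩ : Σ j, Fin (n j)) ≠ ⟨j, l⟩ := fun e => hne (by
        rw [eq_of_heq (Sigma.mk.inj_iff.1 e).2])
      rw [hW.orthogonal _ _ hl, mul_zero, smul_zero]
    · rw [hW.orthogonal _ _ h, zero_mul, smul_zero]
  · simp

theorem mul_mul_eq_sum (hW : IsFrame W) (y z : F) (a b : Σ j, Fin (n j)) :
    star (W a) * (y * z) * W b
      = ∑ c, (star (W a) * y * W c) * (star (W c) * z * W b) := by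
  calc star (W a) * (y * z) * W b = star (W a) * (y * (∑ c, W c * star (W c)) * z) * W b := by
        rw [hW.sum_eq_one, mul_one]
    _ = _ := by
        rw [Finset.mul_sum, Finset.sum_mul, Finset.mul_sum, Finset.sum_mul]
        simp only [mul_assoc]

theorem frameMap_mul (hW : IsFrame W) (x y : MatrixSum n ℂ) :
    frameMap W (x * y) = frameMap W x * frameMap W y := by
  refine hW.ext fun a b => ?_
  by_cases h : a.1 = b.1
  · obtain ⟨j, k⟩ := a
    obtain ⟨j', l⟩ := b
    obtain rfl : j = j' := h
    rw [hW.star_mul_frameMap_mul, hW.mul_mul_eq_sum, Fintype.sum_sigma, Finset.sum_eq_single j]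
    · rw [mul_entry, Finset.sum_smul]
      refine Finset.sum_congr rfl fun r _ => ?_
      rw [hW.star_mul_frameMap_mul, hW.star_mul_frameMap_mul, hW.star_mul_self_eq j r k,
        smul_mul_smul_comm, hW.source_mul_source]
    · intro i _ hi
      refine Finset.sum_eq_zero fun r _ => ?_
      rw [hW.star_mul_frameMap_mul_of_ne x (a := ⟨j, k⟩) (b := ⟨i, r⟩) hi.symm, zero_mul]
    · simp
  · rw [hW.mul_eq_zero a b h, hW.mul_eq_zero a b h]

theorem frameMap_star (hW : IsFrame W) (x : MatrixSum n ℂ) :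
    frameMap W (star x) = star (frameMap W x) := by
  refine hW.ext fun a b => ?_
  by_cases h : a.1 = b.1
  · obtain ⟨j, k⟩ := a
    obtain ⟨j', l⟩ := b
    obtain rfl : j = j' := h
    have := congrArg star (hW.star_mul_frameMap_mul x j l k)
    simp only [star_mul, star_smul, star_star] at this
    rw [hW.star_mul_frameMap_mul, star_entry, mul_assoc, this, hW.star_mul_self_eq j k l]
  · rw [hW.mul_eq_zero a b h, hW.mul_eq_zero a b h]

theorem frameMap_injective (hW : IsFrame W) : Function.Injective (frameMap W) := by
  refine (injective_iff_map_eq_zero _).2 fun x hx => matrixSum_ext fun j k l => ?_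
  have := hW.star_mul_frameMap_mul x j k l
  rw [hx, mul_zero, zero_mul, eq_comm, smul_eq_zero] at this
  exact this.resolve_right (hW.source_ne_zero _)

theorem exists_star_mul_mul (hW : IsFrame W) (z : F) (j : Fin m) (k l : Fin (n j)) :
    ∃ c : ℂ, star (W ⟨j, k⟩) * z * W ⟨j, l⟩ = c • (star (W ⟨j, k⟩) * W ⟨j, k⟩) := by
  -- The element is chosen so that conjugating its corner by `W ⟨j, k⟩` gives back `W ⟨j, k⟩* z W
  -- ⟨j, l⟩`.
  obtain ⟨c, hc⟩ := hW.corner ⟨j, k⟩ (z * W ⟨j, l⟩ * star (W ⟨j, k⟩))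
  refine ⟨c, ?_⟩
  have h1 := congrArg star (hW.mul_star_mul ⟨j, k⟩)
  have h2 := hW.mul_star_mul ⟨j, l⟩
  rw [mul_assoc, hW.star_mul_self_eq j l k] at h2
  simp only [star_mul, star_star] at h1
  have := congrArg (fun t => star (W ⟨j, k⟩) * t * W ⟨j, k⟩) hc
  simp only [mul_smul_comm, smul_mul_assoc] at this
  rw [h1] at this
  rw [← this]
  calc star (W ⟨j, k⟩) * z * W ⟨j, l⟩
      = star (W ⟨j, k⟩) * z * (W ⟨j, l⟩ * (star (W ⟨j, k⟩) * W ⟨j, k⟩)) := by rw [h2]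
    _ = (star (W ⟨j, k⟩) * (W ⟨j, k⟩ * star (W ⟨j, k⟩))) * z *
        (W ⟨j, l⟩ * (star (W ⟨j, k⟩) * (W ⟨j, k⟩ * star (W ⟨j, k⟩) * W ⟨j, k⟩))) := by
          rw [h1, hW.mul_star_mul]
    _ = _ := by simp only [mul_assoc]

theorem frameMap_surjective (hW : IsFrame W) : Function.Surjective (frameMap W) := by
  intro z
  choose c hc using hW.exists_star_mul_mul z
  refine ⟨fun j => CStarMatrix.ofMatrix (Matrix.of (c j)), hW.ext fun a b => ?_⟩
  by_cases h : a.1 = b.1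
  · obtain ⟨j, k⟩ := a
    obtain ⟨j', l⟩ := b
    obtain rfl : j = j' := h
    rw [hW.star_mul_frameMap_mul, hc]
    rfl
  · rw [hW.mul_eq_zero a b h, hW.mul_eq_zero a b h]

/-- The `*`-isomorphism defined by a frame. -/
def starAlgEquiv (hW : IsFrame W) : MatrixSum n ℂ ≃⋆ₐ[ℂ] F :=
  StarAlgEquiv.ofBijective
    ({ frameMap W with
        map_smul' := (frameMap W).map_smul
        map_zero' := (frameMap W).map_zero
        map_mul' := hW.frameMap_mul
        map_star' := hW.frameMap_star } : MatrixSum n ℂ →⋆ₙₐ[ℂ] F)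
    ⟨hW.frameMap_injective, hW.frameMap_surjective⟩

/-- An element of `D` commutes with each range projection `W_b W_b*`. Moving this projection to the
left in `W_a* y W_b` produces the factor `W_a* W_b`, which vanishes for `a ≠ b`. -/
theorem frameMap_mem_iff (hW : IsFrame W) {D : NonUnitalStarSubalgebra ℂ F} (hD : IsAbelian D)
    (hWD : ∀ a, W a * star (W a) ∈ D) (x : MatrixSum n ℂ) :
    frameMap W x ∈ D ↔ x ∈ canonicalDiagonal n ℂ := by
  constructor
  · intro hx j k l hkl
    have hne : (⟨j, k⟩ : Σ j, Fin (n j)) ≠ ⟨j, l⟩ := fun e =>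
      hkl (eq_of_heq (Sigma.mk.inj_iff.1 e).2)
    have h := hW.star_mul_frameMap_mul x j k l
    rw [← hW.mul_star_mul ⟨j, l⟩, ← mul_assoc, mul_assoc (star _) (frameMap W x),
      hD _ hx _ (hWD _), ← mul_assoc, ← mul_assoc, hW.orthogonal _ _ hne, zero_mul, zero_mul,
      zero_mul, eq_comm, smul_eq_zero] at h
    exact h.resolve_right (hW.source_ne_zero _)
  · intro hx
    refine sum_mem fun p _ => ?_
    obtain ⟨j, k, l⟩ := p
    by_cases hkl : k = l
    · subst hkl
      exact SMulMemClass.smul_mem _ (hWD _)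
    · rw [hx j k l hkl, zero_smul]
      exact zero_mem D

end IsFrame

end Frames

/-! ### Finite-dimensional commutative C*-algebras -/

section Commutative

variable (C : Type*) [CommCStarAlgebra C] [FiniteDimensional ℂ C]

theorem finite_characterSpace : Finite (WeakDual.characterSpace ℂ C) := by
  have : Finite (C →ₐ[ℂ] ℂ) := by
    rw [← Cardinal.lt_aleph0_iff_finite]
    exact (cardinalMk_algHom ℂ C ℂ).trans_lt (Cardinal.natCast_lt_aleph0)
  exact Finite.of_injective (WeakDual.CharacterSpace.toAlgHom) fun φ ψ h => by
    ext x; exact DFunLike.congr_fun h x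

/-- A finite-dimensional commutative C*-algebra is spanned by orthogonal projections. -/
theorem exists_orthogonal_projections :
    ∃ (N : ℕ) (p : Fin N → C), (∀ i, IsStarProjection (p i)) ∧ (∀ i, p i ≠ 0) ∧
      (∀ i j, i ≠ j → p i * p j = 0) ∧ ∑ i, p i = 1 ∧ ∀ x, ∃ c : Fin N → ℂ, x = ∑ i, c i • p i := by
  have := finite_characterSpace C
  obtain ⟨N, ⟨e⟩⟩ := Finite.exists_equiv_fin (WeakDual.characterSpace ℂ C)
  let G := gelfandStarTransform C
  -- The character space is finite and Hausdorff, hence discrete, so indicators of points are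
  -- continuous. Their inverse Gelfand transforms are the projections sought.
  let δ : Fin N → C(WeakDual.characterSpace ℂ C, ℂ) := fun i =>
    ⟨fun x => if e x = i then 1 else 0, continuous_of_discreteTopology⟩
  have hexp : ∀ f : C(WeakDual.characterSpace ℂ C, ℂ), f = ∑ i, f (e.symm i) • δ i := fun f => by
    ext x
    simp [δ, ContinuousMap.sum_apply]
  refine ⟨N, fun i => G.symm (δ i), fun i => ⟨?_, ?_⟩, fun i hi => ?_, fun i j hij => ?_, ?_,
    fun x => ⟨fun i => G x (e.symm i), ?_⟩⟩
  · change G.symm (δ i) * G.symm (δ i) = G.symm (δ i)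
    rw [← map_mul]
    congr 1
    ext x
    simp [δ]
  · change star (G.symm (δ i)) = G.symm (δ i)
    rw [← map_star]
    congr 1
    ext x
    simp only [δ, ContinuousMap.star_apply, ContinuousMap.coe_mk]
    split_ifs <;> simp
  · have h0 : δ i = 0 := by
      rw [← G.apply_symm_apply (δ i)]
      exact (congrArg G hi).trans (map_zero G)
    have := DFunLike.congr_fun h0 (e.symm i)
    simp [δ] at this
  · rw [← map_mul, ← map_zero G.symm]
    congr 1
    ext x
    simp only [δ, ContinuousMap.mul_apply, ContinuousMap.coe_mk, ContinuousMap.zero_apply]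
    split_ifs with h1 h2
    · exact absurd (h1.symm.trans h2) hij
    all_goals simp
  · rw [← map_sum, ← map_one G.symm]
    congr 1
    ext x
    simp [δ, ContinuousMap.sum_apply]
  · have := congrArg G.symm (hexp (G x))
    rw [G.symm_apply_apply, map_sum] at this
    simpa only [map_smul] using this

end Commutative

/-! ### Minimal projections of a masa -/

section Masa

variable {F : Type*} [CStarAlgebra F] {D : NonUnitalStarSubalgebra ℂ F}

/-- Self-adjointness of `x` makes `D ∪ {x}` closed under the involution, so it generates an abelian
`*`-algebra, and maximality applies. -/
theorem IsMasa.mem_of_commute (hD : IsMasa D) {x : F} (hx : IsSelfAdjoint x)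
    (h : ∀ d ∈ D, d * x = x * d) : x ∈ D := by
  let s : Set F := insert x (D : Set F)
  have hs : ∀ a ∈ s, ∀ b ∈ s, a * b = b * a := by
    rintro a (rfl | ha) b (rfl | hb)
    · rfl
    · exact (h b hb).symm
    · exact h a ha
    · exact hD.prop a ha b hb
  have hstar : ∀ a ∈ s, star a ∈ s := by
    rintro a (rfl | ha)
    · rw [hx.star_eq]; exact .inl rfl
    · exact .inr (star_mem ha)
  have := NonUnitalStarAlgebra.isMulCommutative_adjoin ℂ hs fun a ha b hb => hs a ha _ (hstar b hb)
  have hE : IsAbelian (NonUnitalStarAlgebra.adjoin ℂ s) := fun a ha b hb =>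
    congrArg Subtype.val (this.is_comm.comm (⟨a, ha⟩ : NonUnitalStarAlgebra.adjoin ℂ s) ⟨b, hb⟩)
  exact hD.le_of_ge hE (fun d hd => NonUnitalStarAlgebra.subset_adjoin ℂ s (.inr hd))
    (NonUnitalStarAlgebra.subset_adjoin ℂ s (.inl rfl))

/-- The minimal projections of a maximal abelian subalgebra of a finite-dimensional C*-algebra. -/
theorem IsMasa.exists_projections [FiniteDimensional ℂ F] (hD : IsMasa D) :
    ∃ (N : ℕ) (p : Fin N → F), (∀ i, p i ∈ D) ∧ (∀ i, IsStarProjection (p i)) ∧ (∀ i, p i ≠ 0) ∧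
      (∀ i j, i ≠ j → p i * p j = 0) ∧ ∑ i, p i = 1 ∧
      ∀ i x, ∃ c : ℂ, p i * x * p i = c • p i := by
  -- With the unit in `D`, the masa is a unital commutative C*-algebra, and Gelfand duality applies
  -- to it.
  have h1 : (1 : F) ∈ D := hD.mem_of_commute (.one F) fun d _ => by simp
  let E : StarSubalgebra ℂ F :=
    { D with
      one_mem' := h1
      zero_mem' := zero_mem D
      algebraMap_mem' := fun c => by
        rw [Algebra.algebraMap_eq_smul_one]
        exact SMulMemClass.smul_mem c h1 }
  have hcl : IsClosed (E : Set F) := (Subalgebra.toSubmodule E.toSubalgebra).closed_of_finiteDimensional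
  let _ : CommCStarAlgebra E :=
    { StarSubalgebra.cstarAlgebra E with
      mul_comm := fun a b => Subtype.ext (hD.prop a a.2 b b.2) }
  have : FiniteDimensional ℂ E := FiniteDimensional.finiteDimensional_submodule
    (Subalgebra.toSubmodule E.toSubalgebra)
  obtain ⟨N, p, hp, hp0, horth, hsum, hspan⟩ := exists_orthogonal_projections E
  have hpF : ∀ i, IsStarProjection (p i : F) := fun i =>
    ⟨congrArg Subtype.val (hp i).isIdempotentElem.eq, congrArg Subtype.val (hp i).isSelfAdjoint.star_eq⟩
  have horthF : ∀ i j, i ≠ j → (p i : F) * p j = 0 := fun i j h => congrArg Subtype.val (horth i j h)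
  have hspanF : ∀ d ∈ D, ∃ c : Fin N → ℂ, d = ∑ i, c i • (p i : F) := fun d hd => by
    obtain ⟨c, hc⟩ := hspan ⟨d, hd⟩
    refine ⟨c, ?_⟩
    have := congrArg E.subtype hc
    rw [map_sum] at this
    exact this
  have hmul : ∀ i, ∀ d ∈ D, ∃ c : ℂ, (p i : F) * d = c • (p i : F) := fun i d hd => by
    obtain ⟨c, rfl⟩ := hspanF d hd
    refine ⟨c i, ?_⟩
    rw [Finset.mul_sum, Finset.sum_eq_single i]
    · rw [mul_smul_comm, (hpF i).isIdempotentElem.eq]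
    · intro j _ hj
      rw [mul_smul_comm, horthF i j hj.symm, smul_zero]
    · simp
  have hsa : ∀ i (x : F), IsSelfAdjoint x → ∃ c : ℂ, (p i : F) * x * p i = c • (p i : F) := by
    intro i x hx
    have hid := (hpF i).isIdempotentElem.eq
    -- Since `p d = d p` is a multiple of `p` for `d` in `D`, the corner element `p x p` commutes
    -- with `D`. It therefore lies in `D`, where multiplication by `p` makes it a multiple of `p`.
    have hmem : (p i : F) * x * p i ∈ D := by
      refine hD.mem_of_commute ?_ fun d hd => ?_
      · rw [isSelfAdjoint_iff, star_mul, star_mul, hx.star_eq, (hpF i).isSelfAdjoint.star_eq,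
          mul_assoc]
      · obtain ⟨c, hc⟩ := hmul i d hd
        have hc' := (hD.prop d hd _ (p i).2).trans hc
        rw [← mul_assoc, ← mul_assoc, hc', mul_assoc _ _ d, hc, smul_mul_assoc, smul_mul_assoc,
          mul_smul_comm]
    obtain ⟨c, hc⟩ := hmul i _ hmem
    refine ⟨c, ?_⟩
    rwa [← mul_assoc, ← mul_assoc, hid] at hc
  refine ⟨N, fun i => p i, fun i => (p i).2, hpF, fun i h => hp0 i (Subtype.ext h), horthF, ?_,
    fun i x => ?_⟩
  · have := congrArg E.subtype hsum
    rw [map_sum] at this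
    exact this
  · obtain ⟨a, ha⟩ := hsa i _ (realPart x).2
    obtain ⟨b, hb⟩ := hsa i _ (imaginaryPart x).2
    refine ⟨a + Complex.I * b, ?_⟩
    conv_lhs => rw [← realPart_add_I_smul_imaginaryPart x]
    rw [mul_add, add_mul, mul_smul_comm, smul_mul_assoc, ha, hb, smul_smul, add_smul]

end Masa

/-! ### Murray-von Neumann equivalence and the structure of masas -/

section Equivalence

variable {F : Type*} [CStarAlgebra F]

/-- Murray-von Neumann equivalence. -/
def MvNEquiv (p q : F) : Prop := ∃ u : F, star u * u = q ∧ u * star u = p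

theorem MvNEquiv.refl {p : F} (hp : IsStarProjection p) : MvNEquiv p p :=
  ⟨p, by rw [hp.isSelfAdjoint.star_eq, hp.isIdempotentElem.eq],
    by rw [hp.isSelfAdjoint.star_eq, hp.isIdempotentElem.eq]⟩

theorem MvNEquiv.symm {p q : F} (h : MvNEquiv p q) : MvNEquiv q p := by
  obtain ⟨u, hq, hp⟩ := h
  exact ⟨star u, by rwa [star_star], by rwa [star_star]⟩

theorem MvNEquiv.trans {p q r : F} (hp : IsStarProjection p) (hr : IsStarProjection r)
    (h : MvNEquiv p q) (h' : MvNEquiv q r) : MvNEquiv p r := by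
  obtain ⟨u, hu, hu'⟩ := h
  obtain ⟨w, hw, hw'⟩ := h'
  refine ⟨u * w, ?_, ?_⟩
  · rw [star_mul, mul_assoc, ← mul_assoc (star u), hu, ← hw', ← mul_assoc, ← mul_assoc, hw,
      mul_assoc, hw, hr.isIdempotentElem.eq]
  · rw [star_mul, mul_assoc, ← mul_assoc w, hw', ← hu, ← mul_assoc, ← mul_assoc, hu',
      mul_assoc, hu', hp.isIdempotentElem.eq]

/-- Minimal projections which are not orthogonal up to conjugation are equivalent. -/
theorem MvNEquiv.of_mul_mul_ne_zero [PartialOrder F] [StarOrderedRing F] {p q : F}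
    (hp : IsStarProjection p) (hq : IsStarProjection q)
    (hpc : ∀ x, ∃ c : ℂ, p * x * p = c • p) (hqc : ∀ x, ∃ c : ℂ, q * x * q = c • q) {x : F}
    (hx : p * x * q ≠ 0) : MvNEquiv p q := by
  have hps := hp.isSelfAdjoint.star_eq
  have hqs := hq.isSelfAdjoint.star_eq
  have hpi := hp.isIdempotentElem.eq
  have hqi := hq.isIdempotentElem.eq
  set y := p * x * q with hy
  have hys : star y = q * star x * p := by rw [hy, star_mul, star_mul, hps, hqs, mul_assoc]
  obtain ⟨c, hc⟩ : ∃ c : ℂ, star y * y = c • q := by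
    obtain ⟨c, hc⟩ := hqc (star x * p * x)
    refine ⟨c, ?_⟩
    rw [← hc, hys, hy]
    calc q * star x * p * (p * x * q) = q * star x * (p * p) * x * q := by simp only [mul_assoc]
      _ = _ := by rw [hpi]; simp only [mul_assoc]
  obtain ⟨c', hc'⟩ : ∃ c : ℂ, y * star y = c • p := by
    obtain ⟨c, hc⟩ := hpc (x * q * star x)
    refine ⟨c, ?_⟩
    rw [← hc, hys, hy]
    calc p * x * q * (q * star x * p) = p * x * (q * q) * star x * p := by simp only [mul_assoc]
      _ = _ := by rw [hqi]; simp only [mul_assoc]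
  have hyq : y * q = y := by rw [hy, mul_assoc, hqi]
  have hpy : p * y = y := by rw [hy, ← mul_assoc, ← mul_assoc, hpi]
  -- Compute `y y* y` in two ways.
  have hcc : c' = c := by
    have h1 : y * star y * y = c' • y := by rw [hc', smul_mul_assoc, hpy]
    have h2 : y * star y * y = c • y := by rw [mul_assoc, hc, mul_smul_comm, hyq]
    exact smul_left_injective ℂ hx (h1.symm.trans h2)
  subst hcc
  have hq0 : q ≠ 0 := fun h => hx (by rw [hy, h, mul_zero])
  have hyy : star y * y ≠ 0 := fun h => hx ((CStarRing.star_mul_self_eq_zero_iff _).1 h)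
  have hreal : star c' = c' := by
    have := congrArg star hc
    rw [star_mul, star_star, star_smul, hqs, hc] at this
    exact (smul_left_injective ℂ hq0 this).symm
  obtain ⟨t, rfl⟩ : ∃ t : ℝ, (t : ℂ) = c' := ⟨c'.re, Complex.conj_eq_iff_re.1 hreal⟩
  -- Otherwise `t q` and `-t q` are both positive, which forces `y* y = 0`. Positivity of `t` allows
  -- `y` to be rescaled to a partial isometry.
  have ht : 0 < t := by
    by_contra! hle
    have h1 : 0 ≤ ((t : ℝ) : ℂ) • q := by rw [← hc]; exact star_mul_self_nonneg y
    have h2 : 0 ≤ (((-t : ℝ)) : ℂ) • q := by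
      have : star ((Real.sqrt (-t) : ℂ) • q) * ((Real.sqrt (-t) : ℂ) • q) = ((-t : ℝ) : ℂ) • q := by
        rw [star_smul, hqs, smul_mul_smul_comm, hqi, Complex.star_def, Complex.conj_ofReal,
          ← Complex.ofReal_mul, Real.mul_self_sqrt (neg_nonneg.2 hle)]
      rw [← this]
      exact star_mul_self_nonneg _
    rw [Complex.ofReal_neg, neg_smul, neg_nonneg] at h2
    exact hyy (hc.trans (le_antisymm h2 h1))
  have hs : ((Real.sqrt t)⁻¹ * (Real.sqrt t)⁻¹) * t = 1 := by
    have : Real.sqrt t ≠ 0 := (Real.sqrt_pos.2 ht).ne'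
    nth_rewrite 3 [← Real.mul_self_sqrt ht.le]
    field_simp
  refine ⟨((Real.sqrt t)⁻¹ : ℝ) • y, ?_, ?_⟩
  · rw [star_smul, smul_mul_smul_comm, hc, star_trivial, Complex.coe_smul, smul_smul, hs, one_smul]
  · rw [star_smul, smul_mul_smul_comm, hc', star_trivial, Complex.coe_smul, smul_smul, hs, one_smul]

/-- The elements of a finite type with an equivalence relation, arranged in blocks. -/
theorem exists_sigma_equiv {α : Type*} [Finite α] (r : Setoid α) :
    ∃ (m : ℕ) (n : Fin m → ℕ) (σ : (Σ j : Fin m, Fin (n j)) ≃ α),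
      ∀ a b, a.1 = b.1 ↔ r (σ a) (σ b) := by
  obtain ⟨m, ⟨e⟩⟩ := Finite.exists_equiv_fin (Quotient r)
  let f : α → Fin m := fun x => e (Quotient.mk r x)
  choose n hn using fun j => Finite.exists_equiv_fin {x // f x = j}
  let g := fun j => (hn j).some
  refine ⟨m, n, (Equiv.sigmaCongrRight fun j => (g j).symm).trans (Equiv.sigmaFiberEquiv f),
    fun a b => ?_⟩
  have key : ∀ a, a.1 = e (Quotient.mk r
      (((Equiv.sigmaCongrRight fun j => (g j).symm).trans (Equiv.sigmaFiberEquiv f)) a)) :=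
    fun a => ((g a.1).symm a.2).2.symm
  rw [key a, key b, e.apply_eq_iff_eq, Quotient.eq]

end Equivalence

/-- A maximal abelian subalgebra of a finite-dimensional C*-algebra is, up to isomorphism, the
canonical diagonal of a direct sum of matrix algebras. -/
theorem exists_starAlgEquiv_of_isMasa {F : Type*} [CStarAlgebra F] [PartialOrder F]
    [StarOrderedRing F] [FiniteDimensional ℂ F] {D : NonUnitalStarSubalgebra ℂ F} (hD : IsMasa D) :
    ∃ (m : ℕ) (n : Fin m → ℕ) (Θ : MatrixSum n ℂ ≃⋆ₐ[ℂ] F),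
      ∀ x, Θ x ∈ D ↔ x ∈ canonicalDiagonal n ℂ := by
  obtain ⟨N, p, hpD, hp, hp0, horth, hsum, hcorner⟩ := hD.exists_projections
  let r : Setoid (Fin N) :=
    { r := fun i j => MvNEquiv (p i) (p j)
      iseqv := ⟨fun i => .refl (hp i), fun h => h.symm, fun {i _ k} h h' => h.trans (hp i) (hp k) h'⟩ }
  -- Each `p i` is linked to the projection of a fixed representative of its class, so the partial
  -- isometries of one block share their source projection.
  have hout : ∀ i, MvNEquiv (p i) (p (Quotient.mk r i).out) := fun i =>
    MvNEquiv.symm (Quotient.mk_out (s := r) i)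
  choose u hu hu' using hout
  obtain ⟨m, n, σ, hσ⟩ := exists_sigma_equiv r
  have huu : ∀ i, u i * star (u i) * u i = u i := fun i =>
    mul_star_mul_self (by rw [hu]; exact hp _)
  have hpu : ∀ i, p i * u i = u i := fun i => by rw [← hu', huu]
  have hup : ∀ i, star (u i) * p i = star (u i) := fun i => by
    rw [← (hp i).isSelfAdjoint.star_eq, ← star_mul, hpu]
  have hW : IsFrame fun a => u (σ a) :=
    { orthogonal := fun a b hab => by
        rw [← hup, ← hpu (σ b), mul_assoc, ← mul_assoc (p _),
          horth _ _ fun h => hab (σ.injective h), zero_mul, mul_zero]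
      ne_zero := fun a h => hp0 (σ a) (by rw [← hu', h, zero_mul])
      star_mul_self_eq := fun j k l => by
        rw [hu, hu, Quotient.sound (s := r) ((hσ ⟨j, k⟩ ⟨j, l⟩).1 rfl)]
      mul_star_mul := fun a => huu _
      sum_eq_one := by
        simp only [hu']
        rw [Equiv.sum_comp σ p, hsum]
      mul_eq_zero := fun a b hab x => by
        by_contra hne
        refine hab ((hσ a b).2 (MvNEquiv.of_mul_mul_ne_zero (hp _) (hp _) (hcorner _) (hcorner _)
          (x := x) fun h => hne ?_))
        rw [← hup, ← hpu (σ b), mul_assoc (star _), mul_assoc, mul_assoc (p _), ← mul_assoc x,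
          ← mul_assoc (p _), ← mul_assoc (p _), h, zero_mul, mul_zero]
      corner := fun a x => by
        rw [hu']
        exact hcorner _ x }
  exact ⟨m, n, hW.starAlgEquiv, hW.frameMap_mem_iff hD.prop fun a => by rw [hu']; exact hpD _⟩

/-! ### Comparison of the two dimensions -/

section Comparison

variable {A : Type*} [NonUnitalCStarAlgebra A] [PartialOrder A] [StarOrderedRing A]
  {H : Type*} [NormedAddCommGroup H] [InnerProductSpace ℂ H] [CompleteSpace H]
  {D : NonUnitalStarSubalgebra ℂ A}

theorem tmul_complex {m : ℕ} {n : Fin m → ℕ} (v : MatrixSum n ℂ) (b : ℂ) : tmul v b = b • v :=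
  matrixSum_ext fun j k l => mul_comm (v j k l) b

theorem DiagDimLE.of_gen {ρ : A →⋆ₙₐ[ℂ] (H →L[ℂ] H)} (hclosed : IsClosed (D : Set A))
    (hnondeg : IsNondegenerate D) (habelian : IsAbelian D) {d : ℕ}
    (h : GenDiagDimLE ρ D ℂ d) : DiagDimLE D d := by
  intro S ε hε
  obtain ⟨m, n, ψ, φ, hψ, happrox, hφ, hψD, hφD, -⟩ := h S ε hε
  refine ⟨fun i => MatrixSum (n i) ℂ, fun i => inferInstance, fun i => inferInstance,
    fun i => inferInstance, fun i => ?_, fun i => canonicalDiagonal (n i) ℂ, ψ, φ,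
    fun i => isMasa_canonicalDiagonal, hψ, happrox, hφ, hψD, fun i v hv => ?_⟩
  · have : ∀ j, FiniteDimensional ℂ (CStarMatrix (Fin (n i j)) (Fin (n i j)) ℂ) := fun j =>
      inferInstanceAs (FiniteDimensional ℂ (Matrix (Fin (n i j)) (Fin (n i j)) ℂ))
    exact inferInstanceAs
      (FiniteDimensional ℂ (∀ j, CStarMatrix (Fin (n i j)) (Fin (n i j)) ℂ))
  · rw [← coe_cpSummand] at *
    -- What is known concerns only the diagonal and the matrix units. Images of diagonal matrix
    -- units are positive normalisers, hence in `D`, and this suffices to reach all normalisers.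
    refine cp_mem_normalisers habelian (cpSummand φ i) (hφ i).2 (fun j l => ?_) (fun j k l => ?_) hv
    · refine mem_of_nonneg_of_mem_normalisers hclosed hnondeg ?_
        ((hφD i).1 _ (matUnit_self_mem j l))
      exact map_nonneg (cpSummand φ i) (isStarProjection_matUnit j l).nonneg
    · have := (hφD i).2 _ (isMatrixUnit_matUnit j k l) 1
      rwa [tmul_complex, one_smul] at this

/-- A product of `*`-homomorphisms. -/
def piMapHom {ι : Type*} [Fintype ι] {E F : ι → Type*} [∀ i, NonUnitalCStarAlgebra (E i)]
    [∀ i, NonUnitalCStarAlgebra (F i)] (f : ∀ i, E i →⋆ₙₐ[ℂ] F i) :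
    (∀ i, E i) →⋆ₙₐ[ℂ] (∀ i, F i) where
  toFun x i := f i (x i)
  map_smul' c x := funext fun i => map_smul (f i) c (x i)
  map_zero' := funext fun i => map_zero (f i)
  map_add' x y := funext fun i => map_add (f i) (x i) (y i)
  map_mul' x y := funext fun i => map_mul (f i) (x i) (y i)
  map_star' x := funext fun i => map_star (f i) (x i)

theorem piMapHom_single {ι : Type*} [Fintype ι] [DecidableEq ι] {E F : ι → Type*}
    [∀ i, NonUnitalCStarAlgebra (E i)] [∀ i, NonUnitalCStarAlgebra (F i)]
    (f : ∀ i, E i →⋆ₙₐ[ℂ] F i) (i : ι) (x : E i) :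
    piMapHom f (Pi.single i x) = Pi.single i (f i x) := by
  ext j
  by_cases h : j = i
  · subst h; simp [piMapHom]
  · simp [piMapHom, h]

theorem tendsto_of_isIncreasingApproximateUnit {l : Filter ℂ}
    (hl : l.IsIncreasingApproximateUnit) : l ≤ 𝓝 1 :=
  (Filter.IsApproximateUnit.iff_neBot_and_le_nhds_one.1 hl.toIsApproximateUnit).2

theorem GenDiagDimLE.of_diagDimLE (ρ : A →⋆ₙₐ[ℂ] (H →L[ℂ] H)) (hclosed : IsClosed (D : Set A))
    (hnondeg : IsNondegenerate D) (habelian : IsAbelian D) {d : ℕ}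
    (h : DiagDimLE D d) : GenDiagDimLE ρ D ℂ d := by
  intro S ε hε
  obtain ⟨F, _, _, _, _, DF, ψ, φ, hDF, hψ, happrox, hφ, hψD, hφD⟩ := h S ε hε
  choose m n Θ hΘ using fun i => exists_starAlgEquiv_of_isMasa (hDF i)
  let f : ∀ i, MatrixSum (n i) ℂ →⋆ₙₐ[ℂ] F i := fun i => (Θ i : MatrixSum (n i) ℂ →⋆ₙₐ[ℂ] F i)
  let g : ∀ i, F i →⋆ₙₐ[ℂ] MatrixSum (n i) ℂ := fun i =>
    ((Θ i).symm : F i →⋆ₙₐ[ℂ] MatrixSum (n i) ℂ)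
  have hfg : ∀ x, piMapHom f (piMapHom g x) = x := fun x => funext fun i =>
    (Θ i).apply_symm_apply (x i)
  let ψ' := cpComp (cpOfHom (piMapHom g)) ψ
  let φ' := cpComp φ (cpOfHom (piMapHom f))
  have hsum : ∀ i x, summand φ' i x = summand φ i (Θ i x) := fun i x =>
    congrArg φ (piMapHom_single f i x)
  have hpos : ∀ i (x : MatrixSum (n i) ℂ), 0 ≤ x → 0 ≤ Θ i x := fun i x hx => map_nonneg (f i) hx
  -- `Θ i` carries the canonical diagonal onto `DF i`, hence normalisers to normalisers.
  have hnormD : ∀ i, ∀ v ∈ normalisers (canonicalDiagonal (n i) ℂ),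
      summand φ' i v ∈ normalisers D := fun i v hv => by
    rw [hsum]
    refine hφD i _ fun x hx => ?_
    obtain ⟨y, rfl⟩ : ∃ y, Θ i y = x := ⟨_, (Θ i).apply_symm_apply x⟩
    rw [hΘ] at hx
    rw [← map_star, ← map_mul, ← map_mul, ← map_mul, ← map_mul, hΘ, hΘ]
    exact hv y hx
  refine ⟨m, n, ψ', φ', fun a => ?_, fun a ha => ?_, fun i => ⟨fun x => ?_, ?_⟩, fun a ha i => ?_,
    fun i => ⟨fun x hx => ?_, fun v hv b => ?_⟩, fun i π hπ l hl v hv => ?_⟩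
  · exact (NonUnitalStarAlgHom.norm_apply_le (piMapHom g) (ψ a)).trans (hψ a)
  · have : φ' (ψ' a) = φ (ψ a) := congrArg φ (hfg (ψ a))
    rw [this]
    exact happrox a ha
  · rw [hsum]
    exact ((hφ i).1 _).trans (NonUnitalStarAlgHom.norm_apply_le (f i) x)
  · intro a a' ha ha' haa'
    rw [hsum, hsum]
    exact (hφ i).2 _ _ (hpos i a ha) (hpos i a' ha') (by rw [← map_mul, haa', map_zero])
  · rw [← hΘ]
    have : Θ i (ψ' a i) = ψ a i := (Θ i).apply_symm_apply (ψ a i)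
    rw [this]
    exact hψD a ha i
  · exact hnormD i x (mem_normalisers_of_mem hx)
  · rw [tmul_complex]
    exact hnormD i _ (smul_mem_normalisers hv.mem_normalisers b)
  · have hmem : ∀ p : MatrixSum (n i) ℂ, IsStarProjection p → p ∈ canonicalDiagonal (n i) ℂ →
        summand φ' i p ∈ D := fun p hp hpD => by
      refine mem_of_nonneg_of_mem_normalisers hclosed hnondeg ?_
        (hnormD i p (mem_normalisers_of_mem hpD))
      exact map_nonneg (cpSummand φ' i) hp.nonneg
    -- `v ⊗ u = u • v` and `u → 1` in `ℂ`, so the strong limit is `π v`.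
    refine ⟨π v, fun ξ => ?_, fun a ha => ?_⟩
    · have h1 : Tendsto (fun u : ℂ => u • π v ξ) l (𝓝 ((1 : ℂ) • π v ξ)) :=
        (tendsto_id'.2 (tendsto_of_isIncreasingApproximateUnit hl)).smul_const _
      rw [one_smul] at h1
      refine h1.congr fun u => ?_
      rw [tmul_complex, map_smul]
      rfl
    · have hcomm : ∀ x ∈ D, Commute (ρ x) (ρ a) := fun x hx => by
        rw [commute_iff_eq, ← map_mul, habelian x hx a ha, map_mul]
      -- The units `1` and `v` are both diagonal projections, so their images lie in `D` and commute
      -- with `a`.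
      refine (hπ.commute hv.2.1 (hcomm _ (hmem 1 (.one _) fun j k l hkl => ?_))
        (hcomm _ (hmem v hv.2.1 hv.1))).eq
      exact CStarMatrix.one_apply_ne hkl

theorem diagDim_eq_genDiagDim_complex (ρ : A →⋆ₙₐ[ℂ] (H →L[ℂ] H)) (hclosed : IsClosed (D : Set A))
    (hnondeg : IsNondegenerate D) (habelian : IsAbelian D) :
    diagDim D = genDiagDim ρ D ℂ := by
  have : ∀ d, DiagDimLE D d ↔ GenDiagDimLE ρ D ℂ d := fun d =>
    ⟨.of_diagDimLE ρ hclosed hnondeg habelian, .of_gen hclosed hnondeg habelian⟩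
  simp only [diagDim, genDiagDim, this]

end Comparison

end DiagDim

end

theorem mainTheorem2 {A : Type*} [NonUnitalCStarAlgebra A] [PartialOrder A] [StarOrderedRing A]
    {H : Type*} [NormedAddCommGroup H] [InnerProductSpace ℂ H] [CompleteSpace H]
    (ρ : A →⋆ₙₐ[ℂ] (H →L[ℂ] H)) (hρ : Function.Injective ρ)
    (D : NonUnitalStarSubalgebra ℂ A) (hDclosed : IsClosed (D : Set A))
    (hDnondeg : DiagDim.IsNondegenerate D) (hDabelian : DiagDim.IsAbelian D) :
    DiagDim.diagDim D = DiagDim.genDiagDim ρ D ℂ :=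
  DiagDim.diagDim_eq_genDiagDim_complex ρ hDclosed hDnondeg hDabelian
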